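/- Let $A$ be a unital $*$-algebra over $\mathbb{C}$ and let $\psi\colon A\to\mathbb{C}$ be a linear functional with $\psi(1)=1$. A self-adjoint element $x$ is called semicircular of variance $v>0$ with respect to a linear functional $\varphi$ if $\varphi(x^m)=\int t^m\,\frac{1}{2\pi v}\sqrt{4v-t^2}\,\mathbf 1_{[-2\sqrt v,2\sqrt v]}(t)\,dt$ for all $m\ge 0$. A family $(x_i)_{i\in I}$ is called a free semicircular family of variance $v$ if each $x_i$ is semicircular of variance $v$ and the unital subalgebras $A_i$ generated by the single elements $x_i$ are free: $\varphi(a_1\cdots a_n)=0$ whenever $n\ge1$, $a_j\in A_{i_j}$, $\varphi(a_j)=0$ for all $j$, and $i_1\ne i_2\ne\cdots\ne i_n$ (consecutive indices differ). Let $N\ge 1$ and let $\{s(i,j,k): 1\le i\le j\le N,\ k=1,2,\dots\}$ be a free semicircular family of variance $1$ in $(A,\psi)$. For $k=1,2,\dots$ let $X_N(k)$ be the $N\times N$ matrix over $A$ whose $(i,j)$ entry is $\sqrt{1+\delta_{i,j}}\;N^{-1/2}\,s(i,j,k)$ if $i\le j$ and $N^{-1/2}\,s(j,i,k)$ if $i>j$.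 Let $\psi_N=\frac1N\mathrm{Tr}\otimes\psi$ on $M_{N\times N}(A)$, that is, $\psi_N(M)=\frac1N\sum_{i=1}^N\psi(M_{ii})$. Then $\{X_N(k):k=1,2,\dots\}$ is a free semicircular family of variance $1+\frac1N$ in $(M_{N\times N}(A),\psi_N)$; in particular each $X_N(k)$ is self-adjoint and semicircular of variance $1+\frac1N$. Moreover, for each $k$, $\psi_N(X_N(k)^m)=0$ if $m$ is odd, and for every $n\ge0$ $$\psi_N\bigl(X_N(k)^{2n}\bigr)=C_n\Bigl(1+\frac1N\Bigr)^n,$$ where $C_n$ is the number of non-crossing pairings of $\{1,\dots,2n\}$. -/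

import Mathlib

namespace FreeProb

variable {A : Type*} [Ring A] [Algebra ℂ A]

/-- Freeness of a family of unital subalgebras of `A` with respect to a linear functional `φ`:
`φ (a₁ a₂ ⋯ aₙ) = 0` whenever `n ≥ 1`, `aⱼ ∈ B (iⱼ)`, `φ aⱼ = 0` for all `j`, and
`i₁ ≠ i₂ ≠ ⋯ ≠ iₙ` (consecutive indices differ). The list entries are the pairs `(iⱼ, aⱼ)`. -/
def FreeSubalgebras {ι : Type*} (φ : A →ₗ[ℂ] ℂ) (B : ι → Subalgebra ℂ A) : Prop :=
  ∀ l : List (ι × A), l ≠ [] →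
    l.IsChain (fun p q => p.1 ≠ q.1) →
    (∀ p ∈ l, p.2 ∈ B p.1 ∧ φ p.2 = 0) →
    φ (l.map Prod.snd).prod = 0

/-- The centered semicircle law of variance `v > 0`, with density
`√(4v - t²) / (2πv)` on `[-2√v, 2√v]` (the real square root vanishes outside that interval). -/
noncomputable def semicircleLaw (v : ℝ) : MeasureTheory.Measure ℝ :=
  MeasureTheory.volume.withDensity
    (fun t => ENNReal.ofReal (Real.sqrt (4 * v - t ^ 2) / (2 * Real.pi * v)))

/-- `x` is a (centered) semicircular element of variance `v`: it is self-adjoint and its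
moments are those of the semicircle law of variance `v`. -/
def IsSemicircular [StarRing A] (φ : A →ₗ[ℂ] ℂ) (v : ℝ) (x : A) : Prop :=
  IsSelfAdjoint x ∧ ∀ m : ℕ, φ (x ^ m) = ((∫ t, t ^ m ∂(semicircleLaw v) : ℝ) : ℂ)

/-- A free semicircular family of variance `v`: each member is semicircular of variance `v`,
and the unital algebras generated by the single members are free. (The members being
self-adjoint, these are also the unital star-algebras that they generate.) -/
def IsFreeSemicircularFamily [StarRing A] {ι : Type*} (φ : A →ₗ[ℂ] ℂ) (v : ℝ)
    (x : ι → A) : Prop :=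
  (∀ i, IsSemicircular φ v (x i)) ∧
    FreeSubalgebras φ (fun i => Algebra.adjoin ℂ {x i})

/-- The functional `ψ_N = (1/N) Tr ⊗ ψ` on `N × N` matrices over `A`, that is
`ψ_N M = (1/N) ∑ i, ψ (M i i)`. -/
noncomputable def matrixFunctional (N : ℕ) (ψ : A →ₗ[ℂ] ℂ) :
    Matrix (Fin N) (Fin N) A →ₗ[ℂ] ℂ :=
  (N : ℂ)⁻¹ • (ψ ∘ₗ Matrix.traceLinearMap (Fin N) ℂ A)

/-- The matrix `X_N(k)`: its `(i, j)` entry is `√(1 + δ_{ij}) N^{-1/2} s(i, j, k)` for `i ≤ j`,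
and equals the `(j, i)` entry for `i > j`. Only the values `s i j k` with `i ≤ j` are used. -/
noncomputable def semicircularMatrix (N : ℕ) (s : Fin N → Fin N → ℕ+ → A) (k : ℕ+) :
    Matrix (Fin N) (Fin N) A :=
  Matrix.of fun i j =>
    (((Real.sqrt (1 + if i = j then 1 else 0) / Real.sqrt N : ℝ) : ℂ)) • s (min i j) (max i j) k

/-- `f` is a non-crossing pairing of `Fin m`: a pairing is the fixed-point-free involution `f`
that exchanges the two elements of each pair, and no two pairs `{i, f i}` and `{j, f j}` cross. -/
def IsNoncrossingPairing {m : ℕ} (f : Fin m → Fin m) : Prop :=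
  (∀ i, f (f i) = i) ∧ (∀ i, f i ≠ i) ∧ ∀ i j, ¬ (i < j ∧ j < f i ∧ f i < f j)

/-- The number `C_n` of non-crossing pairings of a linearly ordered set with `2n` elements. -/
noncomputable def numNoncrossingPairings (n : ℕ) : ℕ :=
  Nat.card {f : Fin (2 * n) → Fin (2 * n) // IsNoncrossingPairing f}

end FreeProb

open MeasureTheory
open Polynomial (aeval)

namespace FreeProb

/-! Everything is read off from joint moments, which are governed by the Schwinger–Dyson equation:
for a free semicircular family of variance 1, `φ (x i * w)` is the sum of `φ w₁ * φ w₂` over the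
splittings `w = w₁ x i w₂` (`IsFreeSemicircularFamily.apply_mul_prod`). It holds because freeness
annihilates every nonempty noncommutative Chebyshev word.

Expanding a word in the matrices entrywise and applying this equation gives, by induction on the
length, that the expectation of the `(a, b)` entry is `δ_ab μ(w)`, where `μ` satisfies the same
recursion with the factor `∑ c, (1 + δ_ac) / N = 1 + 1 / N` (`apply_prod_semicircularMatrix`). The
joint moments of the rescaled free family `√(1 + 1/N) s(0,0,k)` also satisfy this recursion, so the
two families have equal joint moments. Semicircularity and freeness are then transferred by
`FreeSubalgebras.of_moments`.

For a single variable, Schwinger–Dyson is the Catalan-type recursion that counts non-crossing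
pairings by the partner of the first point (`card_isNoncrossingOn`). -/

/-! ### The semicircle law and its Chebyshev polynomials -/

theorem integral_semicircleLaw {v : ℝ} (hv : 0 < v) (g : ℝ → ℝ) :
    ∫ t, g t ∂(semicircleLaw v) =
      ∫ t, √(4 * v - t ^ 2) / (2 * Real.pi * v) * g t := by
  have hpos := Real.pi_pos
  rw [semicircleLaw, integral_withDensity_eq_integral_toReal_smul (by fun_prop) (by simp)]
  refine integral_congr_ae (.of_forall fun t => ?_)
  simp only [smul_eq_mul]
  rw [ENNReal.toReal_ofReal (by positivity)]

theorem integral_pow_semicircleLaw {v : ℝ} (hv : 0 < v) (m : ℕ) :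
    ∫ t, t ^ m ∂(semicircleLaw v) = √v ^ m * ∫ t, t ^ m ∂(semicircleLaw 1) := by
  have hs : 0 < √v := Real.sqrt_pos.2 hv
  have hsv : √v ^ 2 = v := Real.sq_sqrt hv.le
  rw [integral_semicircleLaw hv, integral_semicircleLaw one_pos]
  have h := Measure.integral_comp_mul_left
    (fun t => √(4 * v - t ^ 2) / (2 * Real.pi * v) * t ^ m) (√v)
  rw [abs_of_pos (inv_pos.2 hs), smul_eq_mul, eq_inv_mul_iff_mul_eq₀ hs.ne'] at h
  rw [← h, ← integral_const_mul, ← integral_const_mul]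
  refine integral_congr_ae (.of_forall fun t => ?_)
  have h4 : √(4 * v - (√v * t) ^ 2) = √v * √(4 * 1 - t ^ 2) := by
    rw [← Real.sqrt_mul hv.le]
    congr 1
    rw [mul_pow, hsv]; ring
  beta_reduce
  rw [h4, mul_pow]
  have hp := Real.pi_ne_zero
  field_simp
  rw [hsv]
  ring

theorem integral_odd_pow_semicircleLaw {m : ℕ} (hm : Odd m) :
    ∫ t, t ^ m ∂(semicircleLaw 1) = 0 := by
  rw [integral_semicircleLaw one_pos]
  have h := integral_neg_eq_self
    (fun t : ℝ => √(4 * 1 - t ^ 2) / (2 * Real.pi * 1) * t ^ m) volume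
  simp only [neg_sq, hm.neg_pow, mul_neg, integral_neg] at h
  linarith

theorem integral_semicircleLaw_one_eq_intervalIntegral (g : ℝ → ℝ) :
    ∫ t, g t ∂(semicircleLaw 1) =
      ∫ t in (-2)..2, √(4 - t ^ 2) / (2 * Real.pi) * g t := by
  rw [integral_semicircleLaw one_pos, intervalIntegral.integral_of_le (by norm_num),
    ← integral_indicator measurableSet_Ioc]
  refine integral_congr_ae (.of_forall fun t => ?_)
  by_cases h : t ∈ Set.Ioc (-2 : ℝ) 2
  · simp [h]
  · have h0 : √(4 - t ^ 2) = 0 := Real.sqrt_eq_zero_of_nonpos (by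
      simp only [Set.mem_Ioc, not_and_or, not_lt, not_le] at h
      rcases h with h | h <;> nlinarith)
    simp [h, h0]

theorem integral_semicircleLaw_one_eq_integral_cos {g : ℝ → ℝ} (hg : Continuous g) :
    ∫ t, g t ∂(semicircleLaw 1) =
      ∫ θ in 0..Real.pi, 2 / Real.pi * (g (2 * Real.cos θ) * Real.sin θ * Real.sin θ) := by
  have hp := Real.pi_ne_zero
  have h := intervalIntegral.integral_comp_mul_deriv (a := 0) (b := Real.pi)
    (f := fun θ => 2 * Real.cos θ) (f' := fun θ => 2 * -Real.sin θ)
    (g := fun t => √(4 - t ^ 2) / (2 * Real.pi) * g t)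
    (fun x _ => (Real.hasDerivAt_cos x).const_mul 2) (by fun_prop) (by fun_prop)
  simp only [Real.cos_zero, Real.cos_pi, mul_one, mul_neg] at h
  rw [integral_semicircleLaw_one_eq_intervalIntegral, intervalIntegral.integral_symm, ← h,
    ← intervalIntegral.integral_neg]
  refine intervalIntegral.integral_congr fun θ hθ => ?_
  rw [Set.uIcc_of_le Real.pi_pos.le] at hθ
  have hs : √(4 - (2 * Real.cos θ) ^ 2) = 2 * Real.sin θ := by
    rw [← Real.sqrt_sq (mul_nonneg zero_le_two (Real.sin_nonneg_of_mem_Icc hθ))]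
    congr 1
    linear_combination -4 * Real.sin_sq_add_cos_sq θ
  simp only [Function.comp_apply, hs]
  field_simp

/-- Since `Sₙ(2 cos θ) sin θ = sin ((n + 1) θ)`, the substitution `t = 2 cos θ` turns the integrand
into a multiple of `cos (n θ) - cos ((n + 2) θ)`. The `Sₙ` with `n ≠ 0` thus supply the centered
elements that freeness requires. -/
theorem integral_chebyshev_semicircleLaw_one {n : ℕ} (hn : n ≠ 0) :
    ∫ t, (Polynomial.Chebyshev.S ℝ n).eval t ∂(semicircleLaw 1) = 0 := by
  have hS (θ : ℝ) : (Polynomial.Chebyshev.S ℝ n).eval (2 * Real.cos θ) * Real.sin θ * Real.sin θ =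
      (Real.cos (n * θ) - Real.cos ((n + 2 : ℝ) * θ)) / 2 := by
    have h1 := Polynomial.Chebyshev.U_real_cos θ n
    rw [← Polynomial.Chebyshev.S_comp_two_mul_X] at h1
    simp only [Polynomial.eval_comp, Polynomial.eval_mul, Polynomial.eval_ofNat,
      Polynomial.eval_X, Int.cast_natCast] at h1
    rw [h1, show (n : ℝ) * θ = (n + 1 : ℝ) * θ - θ by ring,
      show (n + 2 : ℝ) * θ = (n + 1 : ℝ) * θ + θ by ring, Real.cos_sub, Real.cos_add]
    ring
  have hc (k : ℕ) (hk : k ≠ 0) : ∫ θ in 0..Real.pi, Real.cos (k * θ) = 0 := by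
    rw [intervalIntegral.integral_comp_mul_left _ (by exact_mod_cast hk)]
    simp
  rw [integral_semicircleLaw_one_eq_integral_cos (by fun_prop)]
  simp only [hS]
  rw [intervalIntegral.integral_const_mul, intervalIntegral.integral_div,
    intervalIntegral.integral_sub (Continuous.intervalIntegrable (by fun_prop) _ _)
      (Continuous.intervalIntegrable (by fun_prop) _ _), hc n hn]
  have := hc (n + 2) (by omega)
  push_cast at this
  simp [this]

theorem integrable_semicircleLaw_one {g : ℝ → ℝ} (hg : Continuous g) :
    Integrable g (semicircleLaw 1) := by
  rw [semicircleLaw, integrable_withDensity_iff (by fun_prop) (by simp)]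
  refine Continuous.integrable_of_hasCompactSupport ?_ ?_
  · simp only [ENNReal.toReal_ofReal']
    fun_prop
  · refine HasCompactSupport.intro (isCompact_Icc (a := (-2 : ℝ)) (b := 2)) fun t ht => ?_
    have h0 : √(4 * 1 - t ^ 2) = 0 := Real.sqrt_eq_zero_of_nonpos (by
      simp only [Set.mem_Icc, not_and_or, not_le] at ht
      rcases ht with h | h <;> nlinarith)
    rw [h0]
    simp

section Semicircular

variable {A : Type*} [Ring A] [StarRing A] [Algebra ℂ A]

theorem IsSemicircular.apply_aeval {φ : A →ₗ[ℂ] ℂ} {x : A} (hx : IsSemicircular φ 1 x)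
    (p : Polynomial ℝ) :
    φ (Polynomial.aeval x (p.map (algebraMap ℝ ℂ))) =
      ((∫ t, p.eval t ∂(semicircleLaw 1) : ℝ) : ℂ) := by
  induction p using Polynomial.induction_on' with
  | add p q hp hq =>
    simp only [Polynomial.map_add, map_add, hp, hq, Polynomial.eval_add]
    rw [integral_add (integrable_semicircleLaw_one (by fun_prop))
      (integrable_semicircleLaw_one (by fun_prop))]
    push_cast; rfl
  | monomial n a =>
    simp only [Polynomial.map_monomial, Polynomial.aeval_monomial, Polynomial.eval_monomial,
      integral_const_mul, ← Algebra.smul_def, map_smul, hx.2 n]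
    simp

theorem IsSemicircular.apply_chebyshev {φ : A →ₗ[ℂ] ℂ} {x : A} (hx : IsSemicircular φ 1 x)
    {n : ℕ} (hn : n ≠ 0) :
    φ (Polynomial.aeval x (Polynomial.Chebyshev.S ℂ n)) = 0 := by
  rw [← Polynomial.Chebyshev.map_S (algebraMap ℝ ℂ), hx.apply_aeval,
    integral_chebyshev_semicircleLaw_one hn, Complex.ofReal_zero]

end Semicircular

/-! ### Sums over splittings of a word -/

/-- The sum of `F i u v` over all decompositions `w = u ++ i :: v` of a word `w`. -/
def splitSum {ι M : Type*} [AddCommMonoid M] (F : ι → List ι → List ι → M) : List ι → M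
  | [] => 0
  | i :: w => F i [] w + splitSum (fun j u v => F j (i :: u) v) w

section SplitSum

variable {ι : Type*}

theorem splitSum_add {M : Type*} [AddCommMonoid M] (F G : ι → List ι → List ι → M) (w : List ι) :
    splitSum (fun i u v => F i u v + G i u v) w = splitSum F w + splitSum G w := by
  induction w generalizing F G with
  | nil => simp [splitSum]
  | cons i w ih =>
    simp only [splitSum]
    rw [ih]
    abel

theorem splitSum_zero {M : Type*} [AddCommMonoid M] (w : List ι) :
    splitSum (fun _ _ _ => (0 : M)) w = 0 := by
  induction w with
  | nil => rfl
  | cons i w ih => simp [splitSum, ih]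

theorem splitSum_mul_left (c : ℂ) (F : ι → List ι → List ι → ℂ) (w : List ι) :
    splitSum (fun i u v => c * F i u v) w = c * splitSum F w := by
  induction w generalizing F with
  | nil => simp [splitSum]
  | cons i w ih =>
    simp only [splitSum]
    rw [ih, mul_add]

theorem splitSum_sum {M κ : Type*} [AddCommMonoid M] (s : Finset κ)
    (F : κ → ι → List ι → List ι → M) (w : List ι) :
    splitSum (fun i u v => ∑ c ∈ s, F c i u v) w = ∑ c ∈ s, splitSum (F c) w := by
  induction w generalizing F with
  | nil => simp [splitSum]
  | cons i w ih =>
    simp only [splitSum]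
    rw [ih, Finset.sum_add_distrib]

theorem splitSum_congr {M : Type*} [AddCommMonoid M] {F G : ι → List ι → List ι → M} (w : List ι)
    (h : ∀ i u v, u.length + v.length + 1 = w.length → F i u v = G i u v) :
    splitSum F w = splitSum G w := by
  induction w generalizing F G with
  | nil => rfl
  | cons i w ih =>
    simp only [splitSum]
    rw [h i [] w (by simp), ih]
    intro j u v huv
    exact h j _ _ (by simp only [List.length_cons]; omega)

theorem splitSum_concat {M : Type*} [AddCommMonoid M] (F : ι → List ι → List ι → M)
    (w : List ι) (j : ι) :
    splitSum F (w ++ [j]) = splitSum (fun i u v => F i u (v ++ [j])) w + F j w [] := by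
  induction w generalizing F with
  | nil => simp [splitSum]
  | cons i w ih =>
    simp only [splitSum, List.cons_append]
    rw [ih, add_assoc]

theorem splitSum_replicate {M : Type*} [AddCommMonoid M] (F : ι → List ι → List ι → M)
    (n : ℕ) (i : ι) :
    splitSum F (List.replicate n i) =
      ∑ p ∈ Finset.range n, F i (List.replicate p i) (List.replicate (n - 1 - p) i) := by
  induction n generalizing F with
  | zero => rfl
  | succ n ih =>
    rw [List.replicate_succ, splitSum, ih, Finset.sum_range_succ', add_comm]
    congr 1
    · refine Finset.sum_congr rfl fun p _ => ?_
      rw [← List.replicate_succ]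
      congr 2
      omega

end SplitSum

/-! ### Chebyshev words and the Schwinger–Dyson equation -/

section ChebyshevWord

variable {A ι : Type*} [Ring A] [DecidableEq ι]

/-- The noncommutative Chebyshev polynomial attached to a word, read from right to left: the
product of the polynomials `Sₙ (x i)` over the maximal blocks `iⁿ` of the word. -/
def chebyshevWord (x : ι → A) : List ι → A
  | [] => 1
  | [i] => x i
  | i :: j :: w => chebyshevWord x (j :: w) * x i - if j = i then chebyshevWord x w else 0

/-- Reversed words make right multiplication a `cons`. As on the full Fock space, a letter acts by
creation plus annihilation. -/
theorem chebyshevWord_cons_mul (x : ι → A) (i j : ι) (w : List ι) :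
    chebyshevWord x (i :: w) * x j =
      chebyshevWord x (j :: i :: w) + if i = j then chebyshevWord x w else 0 := by
  rw [chebyshevWord]
  abel

variable [Algebra ℂ A]

theorem chebyshevWord_replicate_append (x : ι → A) (i : ι) (w : List ι)
    (hw : ∀ j ∈ w.head?, j ≠ i) (n : ℕ) :
    chebyshevWord x (List.replicate n i ++ w) =
      chebyshevWord x w * aeval (x i) (Polynomial.Chebyshev.S ℂ n) := by
  induction n using Nat.twoStepInduction with
  | zero => simp
  | one =>
    cases w with
    | nil => simp [chebyshevWord]
    | cons j w =>
      have : j ≠ i := hw j (by simp)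
      simp [chebyshevWord, this]
  | more n ih0 ih1 =>
    rw [List.replicate_succ, List.replicate_succ, List.cons_append, List.cons_append,
      chebyshevWord, ← List.cons_append, ← List.replicate_succ, ih1, if_pos rfl, ih0]
    push_cast
    rw [Polynomial.Chebyshev.S_add_two, map_sub, mul_comm Polynomial.X, map_mul,
      Polynomial.aeval_X, mul_sub, mul_assoc]

/-- The block at the head of the word, which is the last factor, is kept apart from `l`: a new
letter either lengthens it or closes it and opens another. -/
theorem exists_chebyshevWord_eq_prod (x : ι → A) (w : List ι) (hw : w ≠ []) :
    ∃ (i : ι) (n : ℕ) (w' : List ι) (l : List (ι × A)),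
      w = List.replicate (n + 1) i ++ w' ∧ (∀ j ∈ w'.head?, j ≠ i) ∧
      chebyshevWord x w' = (l.map Prod.snd).prod ∧
      (l ++ [(i, aeval (x i) (Polynomial.Chebyshev.S ℂ (n + 1 : ℕ)))]).IsChain
        (fun p q => p.1 ≠ q.1) ∧
      ∀ p ∈ l, ∃ m : ℕ, m ≠ 0 ∧ p.2 = aeval (x p.1) (Polynomial.Chebyshev.S ℂ m) := by
  induction w with
  | nil => exact absurd rfl hw
  | cons j w ih =>
    rcases eq_or_ne w [] with rfl | hw0
    · exact ⟨j, 0, [], [], by simp, by simp, by simp [chebyshevWord], by simp, by simp⟩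
    · obtain ⟨i, n, w', l, rfl, hi, hprod, hchain, hl⟩ := ih hw0
      rcases eq_or_ne i j with rfl | hij
      · refine ⟨i, n + 1, w', l, rfl, hi, hprod, ?_, hl⟩
        rw [List.isChain_append] at hchain ⊢
        refine ⟨hchain.1, by simp, fun p hp q hq => ?_⟩
        simp only [List.head?_cons, Option.mem_def, Option.some.injEq] at hq
        subst hq
        have h := hchain.2.2 p hp _ rfl
        exact h
      · refine ⟨j, 0, List.replicate (n + 1) i ++ w',
          l ++ [(i, aeval (x i) (Polynomial.Chebyshev.S ℂ (n + 1 : ℕ)))], rfl,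
          ?_, ?_, ?_, ?_⟩
        · simpa [List.replicate_succ] using hij
        · rw [chebyshevWord_replicate_append x i w' hi, hprod]
          simp
        · rw [List.isChain_append]
          refine ⟨hchain, by simp, fun p hp q hq => ?_⟩
          simp only [List.getLast?_append, List.getLast?_singleton, Option.some_or,
            List.head?_cons, Option.mem_def, Option.some.injEq] at hp hq
          subst hp hq
          exact hij
        · intro p hp
          rcases List.mem_append.1 hp with hp | hp
          · exact hl p hp
          · rw [List.mem_singleton] at hp
            subst hp
            exact ⟨n + 1, by simp, rfl⟩

variable [StarRing A]

theorem IsFreeSemicircularFamily.apply_chebyshevWord {φ : A →ₗ[ℂ] ℂ} {x : ι → A}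
    (hx : IsFreeSemicircularFamily φ 1 x) {w : List ι} (hw : w ≠ []) :
    φ (chebyshevWord x w) = 0 := by
  obtain ⟨i, n, w', l, rfl, hi, hprod, hchain, hl⟩ := exists_chebyshevWord_eq_prod x w hw
  rw [chebyshevWord_replicate_append x i w' hi, hprod]
  have h := hx.2 _ (by simp) hchain ?_
  · simpa using h
  · intro p hp
    have hp' : ∃ m : ℕ, m ≠ 0 ∧ p.2 = aeval (x p.1) (Polynomial.Chebyshev.S ℂ m) := by
      rcases List.mem_append.1 hp with hp | hp
      · exact hl p hp
      · rw [List.mem_singleton] at hp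
        subst hp
        exact ⟨n + 1, by simp, rfl⟩
    obtain ⟨m, hm, hpm⟩ := hp'
    rw [hpm]
    exact ⟨Polynomial.aeval_mem_adjoin_singleton ℂ _, (hx.1 p.1).apply_chebyshev hm⟩

/-- The letters of `w` are absorbed one at a time into the Chebyshev word, whose leftmost factor
comes from `i`. The expectation vanishes unless that `i` is eventually annihilated; the sum runs
over the letter of `w` that does so. -/
theorem IsFreeSemicircularFamily.apply_chebyshevWord_mul {φ : A →ₗ[ℂ] ℂ} {x : ι → A}
    (hx : IsFreeSemicircularFamily φ 1 x) (hφ : φ 1 = 1) (i : ι) (w u : List ι) :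
    φ (chebyshevWord x (u ++ [i]) * (w.map x).prod) =
      splitSum (fun j w₁ w₂ => if j = i then
        φ (chebyshevWord x u * (w₁.map x).prod) * φ (w₂.map x).prod else 0) w := by
  induction w generalizing u with
  | nil => simpa [splitSum] using hx.apply_chebyshevWord (w := u ++ [i]) (by simp)
  | cons j w ih =>
    rw [List.map_cons, List.prod_cons, ← mul_assoc, splitSum]
    simp only [List.map_nil, List.map_cons, List.prod_nil, List.prod_cons, mul_one]
    cases u with
    | nil =>
      rw [List.nil_append, chebyshevWord_cons_mul, add_mul, map_add, add_comm]
      congr 1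
      · by_cases h : i = j <;> simp [h, chebyshevWord, hφ, eq_comm]
      · simpa [chebyshevWord] using ih [j]
    | cons a u =>
      have h1 := ih (j :: a :: u)
      have h2 := ih u
      rw [List.cons_append, chebyshevWord_cons_mul, add_mul, map_add]
      rw [List.cons_append, List.cons_append] at h1
      -- The splitting with empty left part vanishes: the letters `a :: u` still stand in front of
      -- `i` in the list.
      rw [h1, hx.apply_chebyshevWord (by simp), zero_mul, ite_self, zero_add]
      simp only [← mul_assoc, chebyshevWord_cons_mul]
      by_cases h : a = j
      · simp only [if_pos h, h2, ← splitSum_add]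
        congr! 4
        split_ifs <;> simp [add_mul]
      · simp [h]

/-- The Schwinger–Dyson equation for a free semicircular family. -/
theorem IsFreeSemicircularFamily.apply_mul_prod {φ : A →ₗ[ℂ] ℂ} {x : ι → A}
    (hx : IsFreeSemicircularFamily φ 1 x) (hφ : φ 1 = 1) (i : ι) (w : List ι) :
    φ (x i * (w.map x).prod) =
      splitSum (fun j w₁ w₂ => if j = i then
        φ (w₁.map x).prod * φ (w₂.map x).prod else 0) w := by
  simpa [chebyshevWord] using hx.apply_chebyshevWord_mul hφ i w []

end ChebyshevWord

/-! ### Counting non-crossing pairings -/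

/-- `f` is an involution of `ℕ` that fixes exactly the numbers outside `[a, b)` and pairs those
inside without crossings. -/
def IsNoncrossingOn (a b : ℕ) (f : ℕ → ℕ) : Prop :=
  (∀ x, f (f x) = x) ∧ (∀ x, a ≤ x ∧ x < b ↔ f x ≠ x) ∧ ∀ x y, ¬ (x < y ∧ y < f x ∧ f x < f y)

/-- No pair crosses `{a, f a}`, so `f` preserves the open interval between them. Working on `ℕ`
avoids reindexing the pieces. -/
theorem IsNoncrossingOn.restrict_left {a b : ℕ} {f : ℕ → ℕ} (hf : IsNoncrossingOn a b f)
    (hab : a < b) :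
    IsNoncrossingOn (a + 1) (f a) (fun x => if a < x ∧ x < f a then f x else x) := by
  obtain ⟨h1, h2, h3⟩ := hf
  have ha : a < f a ∧ f a < b := by
    have := (h2 a).1 ⟨le_rfl, hab⟩
    have := (h2 (f a)).2 (by rw [h1]; exact this.symm)
    omega
  have key (x : ℕ) (hx : a < x ∧ x < f a) : a < f x ∧ f x < f a := by
    have hx' := (h2 x).1 (by omega)
    have hfx := (h2 (f x)).2 (by rw [h1]; exact hx'.symm)
    have := h3 a x
    have e1 : f x ≠ a := fun h => by have := h1 x; rw [h] at this; omega
    have e2 : f x ≠ f a := fun h => by have := h1 x; rw [h, h1] at this; omega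
    omega
  refine ⟨fun x => ?_, fun x => ?_, fun x y => ?_⟩
  · by_cases hx : a < x ∧ x < f a
    · simp [hx, key x hx, h1]
    · simp [hx]
  · by_cases hx : a < x ∧ x < f a
    · simpa [hx, Nat.succ_le_iff] using (h2 x).1 (by omega)
    · simp [hx]
  · have := h3 x y
    have := key x
    beta_reduce
    split_ifs <;> omega

theorem IsNoncrossingOn.restrict_right {a b : ℕ} {f : ℕ → ℕ} (hf : IsNoncrossingOn a b f)
    (hab : a < b) :
    IsNoncrossingOn (f a + 1) b (fun x => if f a < x ∧ x < b then f x else x) := by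
  obtain ⟨h1, h2, h3⟩ := hf
  have ha : a < f a ∧ f a < b := by
    have := (h2 a).1 ⟨le_rfl, hab⟩
    have := (h2 (f a)).2 (by rw [h1]; exact this.symm)
    omega
  have key (x : ℕ) (hx : f a < x ∧ x < b) : f a < f x ∧ f x < b := by
    have hx' := (h2 x).1 (by omega)
    have hfx := (h2 (f x)).2 (by rw [h1]; exact hx'.symm)
    have h4 := h3 a (f x)
    rw [h1] at h4
    have e1 : f x ≠ a := fun h => by have := h1 x; rw [h] at this; omega
    have e2 : f x ≠ f a := fun h => by have := h1 x; rw [h, h1] at this; omega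
    omega
  refine ⟨fun x => ?_, fun x => ?_, fun x y => ?_⟩
  · by_cases hx : f a < x ∧ x < b
    · simp [hx, key x hx, h1]
    · simp [hx]
  · by_cases hx : f a < x ∧ x < b
    · simpa [hx, Nat.succ_le_iff] using (h2 x).1 (by omega)
    · simp [hx]
  · have := h3 x y
    have := key x
    beta_reduce
    split_ifs <;> omega

theorem IsNoncrossingOn.apply_of_notMem {a b : ℕ} {f : ℕ → ℕ} (hf : IsNoncrossingOn a b f) {x : ℕ}
    (hx : ¬ (a ≤ x ∧ x < b)) : f x = x := by
  have := hf.2.1 x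
  tauto

theorem IsNoncrossingOn.mem {a b : ℕ} {f : ℕ → ℕ} (hf : IsNoncrossingOn a b f) {x : ℕ}
    (hx : a ≤ x ∧ x < b) : a ≤ f x ∧ f x < b :=
  (hf.2.1 (f x)).2 (by rw [hf.1]; exact ((hf.2.1 x).1 hx).symm)

theorem IsNoncrossingOn.glue {a b c : ℕ} {g h : ℕ → ℕ} (hac : a < c) (hcb : c < b)
    (hg : IsNoncrossingOn (a + 1) c g) (hh : IsNoncrossingOn (c + 1) b h) :
    IsNoncrossingOn a b
      (fun x => if x = a then c else if x = c then a else if x < c then g x else h x) := by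
  set k : ℕ → ℕ := fun x => if x = a then c else if x = c then a else if x < c then g x else h x
    with hk
  have ka : k a = c := if_pos rfl
  have kc : k c = a := by simp [hk, hac.ne']
  have kl (x : ℕ) (h1 : x ≠ a) (h2 : x < c) : k x = g x := by simp [hk, h1, h2, h2.ne]
  have kr (x : ℕ) (h2 : c < x) : k x = h x := by
    simp [hk, (hac.trans h2).ne', h2.ne', h2.le]
  -- The six zones cut out by `a`, `c` and `b`; each remaining property becomes linear arithmetic
  -- zone by zone.
  have val (x : ℕ) : (x < a ∧ k x = x) ∨ (x = a ∧ k x = c) ∨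
      (a < x ∧ x < c ∧ k x = g x ∧ a < g x ∧ g x < c ∧ g x ≠ x) ∨ (x = c ∧ k x = a) ∨
      (c < x ∧ x < b ∧ k x = h x ∧ c < h x ∧ h x < b ∧ h x ≠ x) ∨ (b ≤ x ∧ k x = x) := by
    rcases lt_trichotomy x a with hx | rfl | hx
    · have := hg.apply_of_notMem (x := x) (by omega)
      exact .inl ⟨hx, by rw [kl x hx.ne (by omega), this]⟩
    · exact .inr (.inl ⟨rfl, ka⟩)
    · rcases lt_trichotomy x c with hx' | rfl | hx'
      · have h1 := hg.mem (x := x) (by omega)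
        have h2 := (hg.2.1 x).1 (by omega)
        have h3 := kl x hx.ne' hx'
        omega
      · exact .inr (.inr (.inr (.inl ⟨rfl, kc⟩)))
      · have h3 := kr x hx'
        by_cases hb : x < b
        · have h1 := hh.mem (x := x) (by omega)
          have h2 := (hh.2.1 x).1 (by omega)
          omega
        · have h1 := hh.apply_of_notMem (x := x) (by omega)
          omega
  refine ⟨fun x => ?_, fun x => ?_, fun x y => ?_⟩
  · rcases val x with ⟨_, h1⟩ | ⟨rfl, h1⟩ | ⟨_, _, h1, h2, h3, _⟩ | ⟨rfl, h1⟩ |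
      ⟨_, _, h1, h2, _, _⟩ | ⟨_, h1⟩
    · rw [h1, h1]
    · rw [h1, kc]
    · rw [h1, kl _ h2.ne' h3, hg.1]
    · rw [h1, ka]
    · rw [h1, kr _ h2, hh.1]
    · rw [h1, h1]
  · rcases val x with h3 | h3 | h3 | h3 | h3 | h3 <;> omega
  · have h1 := hg.2.2 x y
    have h2 := hh.2.2 x y
    rcases val x with h3 | h3 | h3 | h3 | h3 | h3 <;>
      rcases val y with h4 | h4 | h4 | h4 | h4 | h4 <;> omega

/-- The non-crossing pairings of `[a, b)` sorted by the partner of `a`. -/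
def noncrossingFiberEquiv (a b : ℕ) (hab : a < b) :
    {f // IsNoncrossingOn a b f} ≃
      Σ c : ↥(Finset.Ico (a + 1) b), {f // IsNoncrossingOn a b f ∧ f a = c} where
  toFun f := ⟨⟨f.1 a, by
    have h1 := f.2.mem (x := a) ⟨le_rfl, hab⟩
    have h2 := (f.2.2.1 a).1 ⟨le_rfl, hab⟩
    rw [Finset.mem_Ico]
    omega⟩, f.1, f.2, rfl⟩
  invFun p := ⟨p.2.1, p.2.2.1⟩
  left_inv _ := rfl
  right_inv := by
    rintro ⟨⟨c, hc⟩, f, hf, hfc⟩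
    dsimp only at hfc
    subst hfc
    rfl

/-- A non-crossing pairing of `[a, b)` in which `a` is paired with `c` consists of non-crossing
pairings of `[a + 1, c)` and of `[c + 1, b)`. -/
def noncrossingSplitEquiv (a b c : ℕ) (hac : a < c) (hcb : c < b) :
    {f // IsNoncrossingOn a b f ∧ f a = c} ≃
      {g // IsNoncrossingOn (a + 1) c g} × {h // IsNoncrossingOn (c + 1) b h} where
  toFun f := ⟨⟨fun x => if a < x ∧ x < c then f.1 x else x, by
      have h := f.2.1.restrict_left (hac.trans hcb)
      rwa [f.2.2] at h⟩,
    ⟨fun x => if c < x ∧ x < b then f.1 x else x, by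
      have h := f.2.1.restrict_right (hac.trans hcb)
      rwa [f.2.2] at h⟩⟩
  invFun p := ⟨_, p.1.2.glue hac hcb p.2.2, if_pos rfl⟩
  left_inv := by
    rintro ⟨f, hf, hfa⟩
    refine Subtype.ext (funext fun x => ?_)
    have h1 : f c = a := by rw [← hfa, hf.1]
    have h2 (h : ¬ (a ≤ x ∧ x < b)) := hf.apply_of_notMem h
    beta_reduce
    grind
  right_inv := by
    rintro ⟨⟨g, hg⟩, ⟨h, hh⟩⟩
    refine Prod.ext (Subtype.ext (funext fun x => ?_)) (Subtype.ext (funext fun x => ?_))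
    · have h1 (h : ¬ (a + 1 ≤ x ∧ x < c)) := hg.apply_of_notMem h
      beta_reduce
      grind
    · have h1 (h : ¬ (c + 1 ≤ x ∧ x < b)) := hh.apply_of_notMem h
      beta_reduce
      grind

/-- The pairings are fibered over the partner `c` of `a`, and each fiber is a product. Odd lengths
are included: at `n = 0` the sum in `hm` is empty, so `m 1 = 0`. -/
theorem card_isNoncrossingOn {m : ℕ → ℂ} (h0 : m 0 = 1)
    (hm : ∀ n, m (n + 1) = ∑ p ∈ Finset.range n, m p * m (n - 1 - p)) (n a b : ℕ)
    (hb : b = a + n) :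
    Finite {f // IsNoncrossingOn a b f} ∧ (Nat.card {f // IsNoncrossingOn a b f} : ℂ) = m n := by
  induction n using Nat.strong_induction_on generalizing a b with
  | _ n ih =>
    cases n with
    | zero =>
      have hu : Unique {f // IsNoncrossingOn a b f} :=
        { default := ⟨id, by
            refine ⟨fun _ => rfl, fun x => ?_, fun x y => ?_⟩ <;> simp <;> omega⟩
          uniq := fun f => Subtype.ext (funext fun x => f.2.apply_of_notMem (by omega)) }
      exact ⟨inferInstance, by rw [Nat.card_unique, h0, Nat.cast_one]⟩
    | succ n =>
      have hab : a < b := by omega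
      have hc (c : ↥(Finset.Ico (a + 1) b)) :
          Finite {f // IsNoncrossingOn a b f ∧ f a = c} ∧
            (Nat.card {f // IsNoncrossingOn a b f ∧ f a = c} : ℂ) =
              m (c - (a + 1)) * m (b - (c + 1)) := by
        obtain ⟨c, hc⟩ := c
        rw [Finset.mem_Ico] at hc
        obtain ⟨f1, c1⟩ := ih (c - (a + 1)) (by omega) (a + 1) c (by omega)
        obtain ⟨f2, c2⟩ := ih (b - (c + 1)) (by omega) (c + 1) b (by omega)
        have e := noncrossingSplitEquiv a b c (by omega) hc.2
        refine ⟨Finite.of_equiv _ e.symm, ?_⟩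
        rw [Nat.card_congr e, Nat.card_prod, Nat.cast_mul, c1, c2]
      have hfin (c : ↥(Finset.Ico (a + 1) b)) := (hc c).1
      refine ⟨Finite.of_equiv _ (noncrossingFiberEquiv a b hab).symm, ?_⟩
      rw [Nat.card_congr (noncrossingFiberEquiv a b hab), Nat.card_sigma, Nat.cast_sum,
        Finset.sum_congr rfl fun c _ => (hc c).2,
        Finset.sum_coe_sort (Finset.Ico (a + 1) b) fun c => m (c - (a + 1)) * m (b - (c + 1)),
        Finset.sum_Ico_eq_sum_range, hm, show b - (a + 1) = n by omega]
      refine Finset.sum_congr rfl fun p hp => ?_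
      congr 2 <;> omega

/-- Extension of a pairing of `Fin m` to `ℕ` by the identity. -/
def noncrossingPairingEquiv (m : ℕ) :
    {f : Fin m → Fin m // IsNoncrossingPairing f} ≃ {f // IsNoncrossingOn 0 m f} where
  toFun f := ⟨fun x => if h : x < m then f.1 ⟨x, h⟩ else x, by
    obtain ⟨f, h1, h2, h3⟩ := f
    refine ⟨fun x => ?_, fun x => ?_, fun x y => ?_⟩
    · by_cases hx : x < m <;> simp [hx, h1]
    · by_cases hx : x < m
      · simpa [hx, Fin.ext_iff] using h2 ⟨x, hx⟩
      · simp [hx]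
    · by_cases hx : x < m <;> by_cases hy : y < m
      · have h := h3 ⟨x, hx⟩ ⟨y, hy⟩
        beta_reduce
        rw [dif_pos hx, dif_pos hy]
        exact h
      · have := (f ⟨x, hx⟩).2
        simp only [hx, hy, dite_true, dite_false]
        omega
      · simp only [hx, hy, dite_true, dite_false]
        omega
      · simp only [hx, hy, dite_false]
        omega⟩
  invFun g := ⟨fun i => ⟨g.1 i, (g.2.mem ⟨Nat.zero_le _, i.2⟩).2⟩,
    fun i => Fin.ext (g.2.1 i),
    fun i h => (g.2.2.1 i).1 ⟨Nat.zero_le _, i.2⟩ (Fin.ext_iff.1 h),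
    fun i j => g.2.2.2 i j⟩
  left_inv f := by
    refine Subtype.ext (funext fun i => ?_)
    simp
  right_inv g := by
    refine Subtype.ext (funext fun x => ?_)
    by_cases hx : x < m
    · simp [hx]
    · simp [hx, g.2.apply_of_notMem (x := x) (by omega)]

theorem numNoncrossingPairings_eq {m : ℕ → ℂ} (h0 : m 0 = 1)
    (hm : ∀ n, m (n + 1) = ∑ p ∈ Finset.range n, m p * m (n - 1 - p)) (n : ℕ) :
    (numNoncrossingPairings n : ℂ) = m (2 * n) := by
  rw [numNoncrossingPairings, Nat.card_congr (noncrossingPairingEquiv (2 * n))]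
  exact (card_isNoncrossingOn h0 hm (2 * n) 0 (2 * n) (by simp)).2

/-! ### Transfer of freeness through joint moments -/

/-- Freeness of the algebras generated by the single members of a family depends only on the joint
moments of the family. -/
theorem FreeSubalgebras.of_moments {A B κ : Type*} [Ring A] [Algebra ℂ A] [Ring B] [Algebra ℂ B]
    {φ : A →ₗ[ℂ] ℂ} {χ : B →ₗ[ℂ] ℂ} {x : κ → A} {y : κ → B}
    (h : ∀ w : List κ, χ (w.map y).prod = φ (w.map x).prod)
    (hx : FreeSubalgebras φ fun k => Algebra.adjoin ℂ {x k}) :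
    FreeSubalgebras χ fun k => Algebra.adjoin ℂ {y k} := by
  let evx : MonoidAlgebra ℂ (FreeMonoid κ) →ₐ[ℂ] A :=
    MonoidAlgebra.lift ℂ A (FreeMonoid κ) (FreeMonoid.lift x)
  let evy : MonoidAlgebra ℂ (FreeMonoid κ) →ₐ[ℂ] B :=
    MonoidAlgebra.lift ℂ B (FreeMonoid κ) (FreeMonoid.lift y)
  let gen (k : κ) : MonoidAlgebra ℂ (FreeMonoid κ) := MonoidAlgebra.of ℂ _ (FreeMonoid.of k)
  have hgx (k : κ) : evx (gen k) = x k := by simp [evx, gen]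
  have hgy (k : κ) : evy (gen k) = y k := by simp [evy, gen]
  -- Words span the free algebra, so equal moments mean equal pulled-back functionals.
  have hev : χ ∘ₗ evy.toLinearMap = φ ∘ₗ evx.toLinearMap := by
    ext w
    simpa [evx, evy, FreeMonoid.lift_apply] using h w.toList
  intro l hl hchain hmem
  -- Each factor is a polynomial in `y k`; the same polynomial in `x k` is its counterpart, and it
  -- is centered too by `hev`.
  have hpoly (k : κ) (b : B) : ∃ p : Polynomial ℂ, b ∈ Algebra.adjoin ℂ {y k} →
      aeval (y k) p = b := by
    by_cases hb : b ∈ Algebra.adjoin ℂ {y k}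
    · rw [Algebra.adjoin_singleton_eq_range_aeval] at hb
      obtain ⟨p, hp⟩ := hb
      exact ⟨p, fun _ => hp⟩
    · exact ⟨0, fun h => absurd h hb⟩
  choose P hP using hpoly
  have hax (k : κ) (p : Polynomial ℂ) : aeval (x k) p = evx (aeval (gen k) p) := by
    rw [← hgx, Polynomial.aeval_algHom_apply]
  have hay (k : κ) (p : Polynomial ℂ) : aeval (y k) p = evy (aeval (gen k) p) := by
    rw [← hgy, Polynomial.aeval_algHom_apply]
  have hl' : l.map Prod.snd =
      (l.map fun p => aeval (gen p.1) (P p.1 p.2)).map evy := by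
    rw [List.map_map]
    refine List.map_congr_left fun p hp => ?_
    rw [Function.comp_apply, ← hay, hP p.1 p.2 (hmem p hp).1]
  rw [hl', ← map_list_prod]
  have h1 := hx (l.map fun p => (p.1, aeval (x p.1) (P p.1 p.2))) (by simpa using hl)
    (by simpa [List.isChain_map] using hchain) ?_
  · rw [List.map_map] at h1
    have h2 := LinearMap.congr_fun hev (l.map fun p => aeval (gen p.1) (P p.1 p.2)).prod
    simp only [LinearMap.comp_apply, AlgHom.toLinearMap_apply] at h2
    rw [h2, map_list_prod, List.map_map, ← h1]
    congr 2
    exact congrArg (List.map · l) (funext fun p => (hax _ _).symm)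
  · intro q hq
    obtain ⟨p, hp, rfl⟩ := List.mem_map.1 hq
    refine ⟨Polynomial.aeval_mem_adjoin_singleton ℂ _, ?_⟩
    have h2 := LinearMap.congr_fun hev (aeval (gen p.1) (P p.1 p.2))
    simp only [LinearMap.comp_apply, AlgHom.toLinearMap_apply] at h2
    rw [hax, ← h2, ← hay, hP p.1 p.2 (hmem p hp).1]
    exact (hmem p hp).2

/-! ### Schwinger–Dyson for matrix words -/

section MatrixFamily

variable {A ι κ n : Type*} [Ring A] [Algebra ℂ A] [DecidableEq ι] [Fintype n] [DecidableEq n]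

omit [DecidableEq ι] in
theorem apply_mul_prod_matrix (φ : A →ₗ[ℂ] ℂ) (x : ι → A) (α : n → n → ℂ) (f : n → n → κ → ι)
    {X : κ → Matrix n n A} (hX : ∀ k a c, X k a c = α a c • x (f a c k))
    (t : A) (k : κ) (w : List κ) (a b : n) :
    φ (t * ((k :: w).map X).prod a b) =
      ∑ c, α a c * φ (t * x (f a c k) * (w.map X).prod c b) := by
  rw [List.map_cons, List.prod_cons, Matrix.mul_apply, Finset.mul_sum, map_sum]
  refine Finset.sum_congr rfl fun c _ => ?_
  rw [hX, smul_mul_assoc, mul_smul_comm, map_smul, smul_eq_mul, mul_assoc]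

/-- The Schwinger–Dyson equation, extended to words in matrices whose entries are multiples of
members of the family. -/
theorem schwingerDyson_matrix {φ : A →ₗ[ℂ] ℂ} {x : ι → A}
    (hx : ∀ i w, φ (x i * (w.map x).prod) = splitSum (fun j w₁ w₂ => if j = i then
        φ (w₁.map x).prod * φ (w₂.map x).prod else 0) w)
    (α : n → n → ℂ) (f : n → n → κ → ι)
    {X : κ → Matrix n n A} (hX : ∀ k a c, X k a c = α a c • x (f a c k))
    (i : ι) (w : List κ) (u : List ι) (a b : n) :
    φ (x i * (u.map x).prod * (w.map X).prod a b) =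
      splitSum (fun j u₁ u₂ => if j = i then
        φ (u₁.map x).prod * φ ((u₂.map x).prod * (w.map X).prod a b) else 0) u +
      splitSum (fun k w₁ w₂ => ∑ c, ∑ d, if f c d k = i then
        α c d * φ ((u.map x).prod * (w₁.map X).prod a c) * φ ((w₂.map X).prod d b) else 0) w := by
  induction w generalizing u a with
  | nil =>
    by_cases h : a = b
    · simp [h, splitSum, hx]
    · simp [h, splitSum, splitSum_zero]
  | cons k w ih =>
    have hE := apply_mul_prod_matrix φ x α f hX
    -- Expanding the first matrix appends one letter to `u`. The extra splitting at that letter is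
    -- the first term of the sum over `k :: w`.
    have hc := fun c => ih (u ++ [f a c k]) c
    simp only [List.map_append, List.map_cons, List.map_nil, List.prod_append, List.prod_cons,
      List.prod_nil, mul_one, splitSum_concat, ← mul_assoc, one_mul] at hc
    have h1 : splitSum (fun j u₁ u₂ => if j = i then φ (u₁.map x).prod *
          φ ((u₂.map x).prod * ((k :: w).map X).prod a b) else 0) u =
        ∑ c, α a c * splitSum (fun j u₁ u₂ => if j = i then φ (u₁.map x).prod *
          φ ((u₂.map x).prod * x (f a c k) * (w.map X).prod c b) else 0) u := by
      simp only [hE, ← splitSum_mul_left, ← splitSum_sum]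
      congr! 4
      split_ifs
      · rw [Finset.mul_sum]
        exact Finset.sum_congr rfl fun c _ => by ring
      · simp
    have h2 : (∑ c, ∑ d, if f c d k = i then α c d * φ ((u.map x).prod *
          (([] : List κ).map X).prod a c) * φ ((w.map X).prod d b) else 0) =
        ∑ c, α a c * if f a c k = i then
          φ (u.map x).prod * φ ((w.map X).prod c b) else 0 := by
      rw [Finset.sum_eq_single a]
      · refine Finset.sum_congr rfl fun d _ => ?_
        simp [mul_assoc]
      · intro c _ hca
        simp [Ne.symm hca]
      · simp
    have h3 : splitSum (fun k' w₁ w₂ => ∑ c, ∑ d, if f c d k' = i then α c d *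
          φ ((u.map x).prod * ((k :: w₁).map X).prod a c) * φ ((w₂.map X).prod d b) else 0) w =
        ∑ e, α a e * splitSum (fun k' w₁ w₂ => ∑ c, ∑ d, if f c d k' = i then α c d *
          φ ((u.map x).prod * x (f a e k) * (w₁.map X).prod e c) *
            φ ((w₂.map X).prod d b) else 0) w := by
      simp only [hE, ← splitSum_mul_left, ← splitSum_sum]
      congr! 1
      funext k' w₁ w₂
      simp only [Finset.mul_sum]
      rw [Finset.sum_comm]
      conv_rhs => rw [Finset.sum_comm]
      rw [Finset.sum_comm]
      refine Finset.sum_congr rfl fun c _ => ?_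
      rw [Finset.sum_comm]
      refine Finset.sum_congr rfl fun d _ => ?_
      split_ifs
      · rw [Finset.sum_mul]
        exact Finset.sum_congr rfl fun e _ => by ring
      · simp
    rw [hE]
    rw [h1, splitSum, h2, h3, ← Finset.sum_add_distrib, ← Finset.sum_add_distrib]
    refine Finset.sum_congr rfl fun c _ => ?_
    rw [hc]
    ring

end MatrixFamily

/-! ### Moments of the semicircular matrices -/

section SemicircularMatrix

variable {A : Type*} [Ring A] [Algebra ℂ A]

/-- The index of the `(a, b)` entry of the `k`-th symmetric matrix. -/
def entryIndex {N : ℕ} (a b : Fin N) (k : ℕ+) : {q : Fin N × Fin N × ℕ+ // q.1 ≤ q.2.1} :=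
  ⟨(min a b, max a b, k), min_le_max⟩

/-- Both unordered pairs contain `c`, so their other members must agree. This makes the entry
expectations diagonal. -/
theorem entryIndex_eq_iff {N : ℕ} {a b c : Fin N} {k l : ℕ+} :
    entryIndex c b l = entryIndex a c k ↔ a = b ∧ l = k := by
  simp only [entryIndex, Subtype.mk.injEq, Prod.mk.injEq]
  refine ⟨fun ⟨h1, h2, h3⟩ => ⟨?_, h3⟩, ?_⟩
  · rcases le_total c b with h | h <;> rcases le_total a c with h' | h' <;>
      simp_all
  · rintro ⟨rfl, rfl⟩
    exact ⟨min_comm _ _, max_comm _ _, rfl⟩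

/-- The normalizing factor of the `(a, b)` entry of a semicircular matrix. -/
noncomputable def entryCoeff {N : ℕ} (a b : Fin N) : ℂ :=
  ((√(1 + if a = b then 1 else 0) / √N : ℝ) : ℂ)

theorem entryCoeff_comm {N : ℕ} (a b : Fin N) : entryCoeff a b = entryCoeff b a := by
  simp only [entryCoeff, eq_comm]

theorem sum_entryCoeff_mul {N : ℕ} (a : Fin N) :
    ∑ c, entryCoeff a c * entryCoeff c a = 1 + 1 / (N : ℂ) := by
  have hN : (N : ℝ) ≠ 0 := by
    have := a.pos
    positivity
  have h (c : Fin N) : entryCoeff a c * entryCoeff c a =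
      (((1 + if a = c then 1 else 0) / N : ℝ) : ℂ) := by
    have h1 : (0 : ℝ) ≤ 1 + if a = c then 1 else 0 := by split_ifs <;> norm_num
    rw [entryCoeff_comm c a, entryCoeff, ← Complex.ofReal_mul, div_mul_div_comm,
      Real.mul_self_sqrt h1, Real.mul_self_sqrt (Nat.cast_nonneg N)]
  simp only [h]
  rw [← Complex.ofReal_sum, ← Finset.sum_div, Finset.sum_add_distrib]
  simp only [Finset.sum_const, Finset.card_univ, Fintype.card_fin, nsmul_eq_mul, mul_one,
    Finset.sum_ite_eq, Finset.mem_univ, if_true]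
  rw [add_div, div_self hN]
  push_cast
  rfl

/-- The entries of a word in semicircular matrices have scalar-matrix expectation, given by any
function on words that satisfies the Schwinger–Dyson recursion of variance `1 + 1 / N`. -/
theorem apply_prod_semicircularMatrix {N : ℕ} {ψ : A →ₗ[ℂ] ℂ} (hψ : ψ 1 = 1)
    {s : Fin N → Fin N → ℕ+ → A}
    {x : {q : Fin N × Fin N × ℕ+ // q.1 ≤ q.2.1} → A} (hxs : x = fun p => s p.1.1 p.1.2.1 p.1.2.2)
    (hx : ∀ i w, ψ (x i * (w.map x).prod) = splitSum (fun j w₁ w₂ => if j = i then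
        ψ (w₁.map x).prod * ψ (w₂.map x).prod else 0) w)
    {μ : List ℕ+ → ℂ} (hμ0 : μ [] = 1)
    (hμ : ∀ k w, μ (k :: w) = (1 + 1 / (N : ℂ)) *
      splitSum (fun l w₁ w₂ => if l = k then μ w₁ * μ w₂ else 0) w)
    (w : List ℕ+) (a b : Fin N) :
    ψ ((w.map (semicircularMatrix N s)).prod a b) = if a = b then μ w else 0 := by
  have hX (k : ℕ+) (a c : Fin N) :
      semicircularMatrix N s k a c = entryCoeff a c • x (entryIndex a c k) := by
    rw [hxs]; rfl
  induction hn : w.length using Nat.strong_induction_on generalizing w a b with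
  | _ n ih =>
    subst hn
    cases w with
    | nil => by_cases h : a = b <;> simp [h, hψ, hμ0]
    | cons k w =>
      have h1 := apply_mul_prod_matrix ψ x entryCoeff entryIndex hX 1 k w a b
      have h2 (c : Fin N) := schwingerDyson_matrix hx entryCoeff entryIndex hX
        (entryIndex a c k) w [] c b
      simp only [List.map_nil, List.prod_nil, mul_one, one_mul, splitSum, zero_add] at h1 h2
      rw [h1]
      simp only [h2, ← splitSum_mul_left, ← splitSum_sum]
      rw [splitSum_congr (G := fun l w₁ w₂ =>
        (if a = b then 1 + 1 / (N : ℂ) else 0) * if l = k then μ w₁ * μ w₂ else 0),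
        splitSum_mul_left, hμ]
      · split_ifs <;> simp
      intro l w₁ w₂ hw
      have e1 (c d : Fin N) := ih w₁.length (by simp only [List.length_cons]; omega) w₁ c d rfl
      have e2 (c d : Fin N) := ih w₂.length (by simp only [List.length_cons]; omega) w₂ c d rfl
      -- By induction the two shorter words have diagonal expectations, which forces `d = c` and `e
      -- = b`; equality of the indices then leaves only `a = b` and `l = k`.
      have e3 (c : Fin N) : (∑ d, ∑ e, if entryIndex d e l = entryIndex a c k then
          entryCoeff d e * ψ ((w₁.map (semicircularMatrix N s)).prod c d) *
            ψ ((w₂.map (semicircularMatrix N s)).prod e b) else 0) =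
          entryCoeff c a * ((if a = b then 1 else 0) * if l = k then μ w₁ * μ w₂ else 0) := by
        rw [Finset.sum_eq_single c, Finset.sum_eq_single b]
        · rw [e1, e2, if_pos rfl, if_pos rfl]
          by_cases hab : a = b <;> by_cases hlk : l = k <;>
            simp [entryIndex_eq_iff, hab, hlk, mul_assoc]
        · intro e _ heb
          simp [e2, heb]
        · simp
        · intro d _ hdc
          simp [e1, hdc.symm]
        · simp
      simp only [e3, ← mul_assoc, ← Finset.sum_mul, sum_entryCoeff_mul]
      split_ifs <;> simp

theorem matrixFunctional_apply {N : ℕ} (ψ : A →ₗ[ℂ] ℂ) (M : Matrix (Fin N) (Fin N) A) :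
    matrixFunctional N ψ M = (N : ℂ)⁻¹ * ∑ a, ψ (M a a) := by
  simp [matrixFunctional, Matrix.trace]

variable [StarRing A]

theorem IsFreeSemicircularFamily.comp_injective {ι κ : Type*} {φ : A →ₗ[ℂ] ℂ} {v : ℝ} {x : ι → A}
    (hx : IsFreeSemicircularFamily φ v x) {g : κ → ι} (hg : g.Injective) :
    IsFreeSemicircularFamily φ v (x ∘ g) := by
  refine ⟨fun k => hx.1 (g k), fun l hl hchain hmem => ?_⟩
  have h := hx.2 (l.map fun p => (g p.1, p.2)) (by simpa using hl)
    (by simpa [List.isChain_map, hg.eq_iff] using hchain) ?_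
  · rwa [List.map_map] at h
  · intro q hq
    obtain ⟨p, hp, rfl⟩ := List.mem_map.1 hq
    exact hmem p hp

variable [StarModule ℂ A]

theorem IsFreeSemicircularFamily.smul_sqrt {κ : Type*} {φ : A →ₗ[ℂ] ℂ} {x : κ → A}
    (hx : IsFreeSemicircularFamily φ 1 x) {v : ℝ} (hv : 0 < v) :
    IsFreeSemicircularFamily φ v (fun k => ((√v : ℝ) : ℂ) • x k) := by
  refine ⟨fun k => ⟨?_, fun m => ?_⟩, fun l hl hchain hmem => ?_⟩
  · rw [IsSelfAdjoint, star_smul, (hx.1 k).1.star_eq]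
    simp
  · rw [smul_pow, map_smul, (hx.1 k).2, integral_pow_semicircleLaw hv]
    push_cast
    rfl
  · refine hx.2 l hl hchain fun p hp => ⟨?_, (hmem p hp).2⟩
    refine Algebra.adjoin_le ?_ (hmem p hp).1
    exact Set.singleton_subset_iff.2
      (Subalgebra.smul_mem _ (Algebra.self_mem_adjoin_singleton ℂ _) _)

theorem isSelfAdjoint_semicircularMatrix {N : ℕ} {s : Fin N → Fin N → ℕ+ → A}
    (hs : ∀ i j k, i ≤ j → IsSelfAdjoint (s i j k)) (k : ℕ+) :
    IsSelfAdjoint (semicircularMatrix N s k) := by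
  ext i j
  change star (entryCoeff j i • s (min j i) (max j i) k) = entryCoeff i j • s (min i j) (max i j) k
  rw [star_smul, (hs _ _ k min_le_max).star_eq, min_comm, max_comm, entryCoeff_comm, entryCoeff]
  simp

end SemicircularMatrix

end FreeProb

/-! ### The main theorem -/

open FreeProb in
theorem mainTheorem8 {A : Type*} [Ring A] [StarRing A] [Algebra ℂ A] [StarModule ℂ A]
    (ψ : A →ₗ[ℂ] ℂ) (hψ : ψ 1 = 1) (N : ℕ) (hN : 1 ≤ N)
    (s : Fin N → Fin N → ℕ+ → A)
    (hs : FreeProb.IsFreeSemicircularFamily ψ 1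
      (fun p : {q : Fin N × Fin N × ℕ+ // q.1 ≤ q.2.1} => s p.1.1 p.1.2.1 p.1.2.2)) :
    FreeProb.IsFreeSemicircularFamily (FreeProb.matrixFunctional N ψ) (1 + 1 / (N : ℝ))
        (fun k : ℕ+ => FreeProb.semicircularMatrix N s k) ∧
      (∀ (k : ℕ+) (m : ℕ), Odd m →
        FreeProb.matrixFunctional N ψ (FreeProb.semicircularMatrix N s k ^ m) = 0) ∧
      (∀ (k : ℕ+) (n : ℕ),
        FreeProb.matrixFunctional N ψ (FreeProb.semicircularMatrix N s k ^ (2 * n)) =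
          (FreeProb.numNoncrossingPairings n : ℂ) * (1 + 1 / (N : ℂ)) ^ n) := by
  obtain ⟨x, hx⟩ : ∃ x, x = fun p : {q : Fin N × Fin N × ℕ+ // q.1 ≤ q.2.1} =>
    s p.1.1 p.1.2.1 p.1.2.2 := ⟨_, rfl⟩
  rw [← hx] at hs
  have hNC : (N : ℂ) ≠ 0 := by exact_mod_cast (by omega : N ≠ 0)
  -- The diagonal entries at a fixed position serve as a model free family indexed by `k`.
  let o : Fin N := ⟨0, hN⟩
  have hinj : (entryIndex o o).Injective := fun k l h => (entryIndex_eq_iff.1 h).2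
  have hz := hs.comp_injective hinj
  set z : ℕ+ → A := x ∘ entryIndex o o
  have hv : (0 : ℝ) < 1 + 1 / N := by positivity
  have hy := hz.smul_sqrt hv
  set r : ℂ := ((√(1 + 1 / N) : ℝ) : ℂ) with hr
  have hr2 : r ^ 2 = 1 + 1 / (N : ℂ) := by
    rw [hr, ← Complex.ofReal_pow, Real.sq_sqrt hv.le]
    push_cast
    rfl
  have hyz (w : List ℕ+) : (w.map fun k => r • z k).prod = r ^ w.length • (w.map z).prod := by
    induction w with
    | nil => simp
    | cons k w ih =>
      rw [List.map_cons, List.prod_cons, ih, List.map_cons, List.prod_cons, smul_mul_smul_comm,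
        List.length_cons, pow_succ']
  have hmom (w : List ℕ+) : matrixFunctional N ψ (w.map (semicircularMatrix N s)).prod =
      ψ (w.map fun k => r • z k).prod := by
    have h := apply_prod_semicircularMatrix hψ hx (hs.apply_mul_prod hψ)
      (μ := fun w => ψ (w.map fun k => r • z k).prod) (by simpa using hψ) ?_ w
    · simp [matrixFunctional_apply, h, hNC]
    · intro k w
      simp only [hyz, map_smul, smul_eq_mul, List.length_cons]
      rw [List.map_cons, List.prod_cons, hz.apply_mul_prod hψ, ← splitSum_mul_left,
        ← splitSum_mul_left]
      refine splitSum_congr w fun l w₁ w₂ hw => ?_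
      -- The two matched letters, the leading `k` and the `l` at the splitting, account for the
      -- factor `r ^ 2`.
      rw [← hw, ← hr2]
      split_ifs <;> ring
  have hpow (k : ℕ+) (m : ℕ) : matrixFunctional N ψ (semicircularMatrix N s k ^ m) =
      ψ ((r • z k) ^ m) := by
    simpa using hmom (List.replicate m k)
  refine ⟨⟨fun k => ⟨isSelfAdjoint_semicircularMatrix (fun i j k hij => ?_) k, fun m => ?_⟩,
    hy.2.of_moments hmom⟩, fun k m hm => ?_, fun k n => ?_⟩
  · have h := (hs.1 ⟨(i, j, k), hij⟩).1
    rwa [hx] at h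
  · rw [hpow, (hy.1 k).2]
  · rw [hpow, smul_pow, map_smul, (hz.1 k).2, integral_odd_pow_semicircleLaw hm]
    simp
  · rw [hpow, smul_pow, map_smul, pow_mul, hr2, smul_eq_mul, mul_comm,
      numNoncrossingPairings_eq (m := fun m => ψ (z k ^ m)) (by simpa using hψ) fun n => ?_]
    -- On a constant word, Schwinger–Dyson is the recursion for non-crossing pairings.
    have h := hz.apply_mul_prod hψ k (List.replicate n k)
    rw [splitSum_replicate] at h
    simpa [pow_succ'] using h
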